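/- For graphs $P,Q$ and an integer $n\ge 0$, let $\mathrm{ex}(n,P,Q\text{-ind})$ denote the maximum number of edges in an $n$-vertex simple graph that has no subgraph isomorphic to $P$ and no induced subgraph isomorphic to $Q$. For integers $k\ge 3$ and $0\le j\le k-2$, let $\mathcal C_{k,j}$ be the family of all simple graphs obtained from a cycle $C_k$ by adding exactly $j$ further edges, all incident to one particular vertex $v$ of the cycle (the other endpoint of each added edge is either a vertex of the cycle not adjacent to $v$ in $C_k$, so that the edge is a chord, or a new vertex, so that the edge is pendant). Let $k\ge 3$, $t\ge 3$ and $0\le j\le k-2$ be integers, and let $H\in\mathcal C_{k,j}$. Then \[\mathrm{ex}(n,H,K_{1,t}\text{-ind})\le \tfrac12 (k-2)(t-1)\,n\quad\text{for all } n,\] and equality holds for infinitely many values of $n$. -/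

import Mathlib

open Classical in
/-- The induced Turán number: the maximum number of edges of a graph on `n` vertices that has no
subgraph isomorphic to `P` and no induced subgraph isomorphic to `Q`. -/
noncomputable def inducedTuranNumber {U W : Type*} (n : ℕ) (P : SimpleGraph U)
    (Q : SimpleGraph W) : ℕ :=
  Finset.sup {G : SimpleGraph (Fin n) | P.Free G ∧ ¬ Q.IsIndContained G}
    (fun G => G.edgeFinset.card)

/-- `IsCycleWithEdges k j H` says that `H` is obtained from a cycle on `k` vertices (embedded by
`c`) by adding exactly `j` further edges, all incident to one cycle vertex `c r`. The finset `S`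
consists of the other endpoints of the added edges. Each of them either lies on the cycle (the
added edge is a chord) or does not (the added edge is pendant), and every vertex of `H` is on the
cycle or is such an endpoint. -/
def IsCycleWithEdges (k j : ℕ) {W : Type*} (H : SimpleGraph W) : Prop :=
  ∃ (c : Fin k ↪ W) (r : Fin k) (S : Finset W),
    S.card = j ∧
    c r ∉ S ∧
    (∀ s ∈ S, ¬ ((SimpleGraph.cycleGraph k).map c).Adj (c r) s) ∧
    (∀ w : W, w ∈ Set.range c ∨ w ∈ S) ∧
    (∀ a b : W, H.Adj a b ↔
      ((SimpleGraph.cycleGraph k).map c).Adj a b ∨ (a = c r ∧ b ∈ S) ∨ (b = c r ∧ a ∈ S))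

/-! Upper bound: every degree is at most `(k-2)(t-1)`. A larger neighbourhood of `v` contains either
`t` independent vertices, hence an induced star, or a path on `k-1` vertices
(`exists_isIndepSet_or_path`). With `v` the path closes to a `k`-cycle having every chord at `v`,
and enough neighbours remain for pendant edges.

Lower bound: since `H` contains `C_k`, it suffices to find arbitrarily large `C_k`-free graphs,
regular of degree `(k-2)(t-1)`, without induced `K_{1,t}`. The Cayley graph of a free product of
`t-1` copies of `ZMod (k-1)` is a tree of `(k-1)`-cliques with these properties, but infinite.
Letting the letters permute the reduced words of length at most `k` gives a finite group whose
Cayley graph agrees with it closely enough to exclude `C_k`; disjoint copies give infinitely many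
orders. -/

/-! ### Upper bound: local structure of neighbourhoods. -/

/-- A finite vertex set with more than `ℓ * m` elements contains an independent set of size
`m + 1` or a path on `ℓ + 1` vertices. -/
lemma SimpleGraph.exists_isIndepSet_or_path {V : Type*} (G : SimpleGraph V) (ℓ m : ℕ)
    (A : Finset V) (hA : ℓ * m < A.card) :
    (∃ I ⊆ A, I.card = m + 1 ∧ G.IsIndepSet (I : Set V)) ∨
      ∃ p : List V, p.IsChain G.Adj ∧ p.Nodup ∧ (∀ x ∈ p, x ∈ A) ∧ p.length = ℓ + 1 := by
  classical
  induction m generalizing A with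
  | zero =>
    obtain ⟨x, hx⟩ := Finset.card_pos.mp (by simpa using hA)
    exact Or.inl ⟨{x}, by simpa using hx, by simp, by simp [SimpleGraph.IsIndepSet]⟩
  | succ m ih =>
    rw [or_iff_not_imp_right]
    intro hno
    let Q : ℕ → Prop := fun l =>
      ∃ p : List V, p.IsChain G.Adj ∧ p.Nodup ∧ (∀ x ∈ p, x ∈ A) ∧ p.length = l + 1
    have hQ0 : Q 0 := by
      obtain ⟨x, hx⟩ := Finset.card_pos.mp (by omega : 0 < A.card)
      exact ⟨[x], by simp, by simp, by simpa using hx, by simp⟩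
    -- A path in `A` with at most `ℓ` vertices and no longer path in `A`: its head has no neighbour
    -- in `A` off the path, so it can join the independent set found there.
    obtain ⟨l, hl, ⟨p, hpc, hpn, hpA, hpl⟩, hmax⟩ : ∃ l < ℓ, Q l ∧ ¬ Q (l + 1) := by
      by_contra! h
      have : ∀ l ≤ ℓ, Q l := by
        intro l
        induction l with
        | zero => exact fun _ => hQ0
        | succ l ihl => exact fun hle => h l (by omega) (ihl (by omega))
      exact hno (this ℓ le_rfl)
    obtain ⟨u, q, rfl⟩ : ∃ u q, p = u :: q := by
      cases p with
      | nil => simp at hpl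
      | cons u q => exact ⟨u, q, rfl⟩
    have hsub : (u :: q).toFinset ⊆ A := fun x hx => hpA x (by simpa using hx)
    have hcard : (A \ (u :: q).toFinset).card + (l + 1) = A.card := by
      rw [← hpl, ← List.toFinset_card_of_nodup hpn]
      exact Finset.card_sdiff_add_card_eq_card hsub
    have hbig : ℓ * m < (A \ (u :: q).toFinset).card := by
      rw [Nat.mul_succ] at hA
      omega
    rcases ih _ hbig with ⟨I, hIA, hIc, hI⟩ | ⟨p, h1, h2, h3, h4⟩
    · have huI : u ∉ I := fun h => by simpa using hIA h
      have hadj : ∀ w ∈ I, ¬ G.Adj u w := by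
        intro w hw huw
        have hwA := Finset.mem_sdiff.mp (hIA hw)
        refine hmax ⟨w :: u :: q, ?_, ?_, ?_, by simpa using hpl⟩
        · exact List.isChain_cons_cons.mpr ⟨huw.symm, hpc⟩
        · exact List.nodup_cons.mpr ⟨by simpa using hwA.2, hpn⟩
        · intro x hx
          rcases List.mem_cons.mp hx with rfl | hx
          · exact hwA.1
          · exact hpA x hx
      refine ⟨insert u I, ?_, by rw [Finset.card_insert_of_notMem huI, hIc], ?_⟩
      · exact Finset.insert_subset (hpA u (by simp)) (hIA.trans Finset.sdiff_subset)
      · rw [Finset.coe_insert, SimpleGraph.IsIndepSet, Set.pairwise_insert]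
        exact ⟨hI, fun w hw _ => ⟨hadj w hw, fun h => hadj w hw h.symm⟩⟩
    · exact absurd ⟨p, h1, h2, fun x hx => (Finset.mem_sdiff.mp (h3 x hx)).1, h4⟩ hno

lemma SimpleGraph.star_isIndContained_of_isIndepSet {V : Type*} (G : SimpleGraph V) (v : V)
    (I : Finset V) (hv : ∀ x ∈ I, G.Adj v x) (hI : G.IsIndepSet (I : Set V)) {t : ℕ}
    (ht : I.card = t) : (completeBipartiteGraph (Fin 1) (Fin t)).IsIndContained G := by
  subst ht
  let e := I.equivFin.symm
  have hv' : ∀ a, G.Adj v (e a) := fun a => hv _ (e a).2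
  refine ⟨⟨⟨Sum.elim (fun _ => v) (fun a => (e a : V)), ?_⟩, ?_⟩⟩
  · rintro (a | a) (b | b) h
    · rw [Subsingleton.elim a b]
    · exact absurd h (hv' b).ne
    · exact absurd h (hv' a).ne'
    · simpa using h
  · rintro (a | a) (b | b)
    · change G.Adj v v ↔ _
      simp
    · change G.Adj v (e b) ↔ _
      simpa using hv' b
    · change G.Adj (e a) v ↔ _
      simpa using (hv' a).symm
    · change G.Adj (e a) (e b) ↔ _
      have : ¬ G.Adj (e a) (e b) := fun h => hI (e a).2 (e b).2 h.ne h
      simpa using this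

/-- A vertex `v` with a path on `k - 1` vertices among its neighbours, and with at least `j`
further neighbours, is the centre of a copy of any cycle with `j` added edges. -/
lemma IsCycleWithEdges.isContained {l j : ℕ} {W V : Type*} {H : SimpleGraph W}
    (hH : IsCycleWithEdges (l + 2) j H) (G : SimpleGraph V) (v : V) (p : List V)
    (hpc : p.IsChain G.Adj) (hpn : p.Nodup) (hpv : ∀ x ∈ p, G.Adj v x) (hpl : p.length = l + 1)
    (B : Finset V) (hB : ∀ x ∈ B, G.Adj v x ∧ x ∉ p) (hBj : j ≤ B.card) :
    H.IsContained G := by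
  classical
  obtain ⟨c, r, S, hS, hrS, -, hcov, hadj⟩ := hH
  obtain ⟨f⟩ : Nonempty (S ↪ B) := Function.Embedding.nonempty_of_card_le (by simpa [hS] using hBj)
  let z : Fin (l + 2) → V := Fin.cons v (fun i => p[i.1]'(by omega))
  have hz0 : z 0 = v := rfl
  have hzs : ∀ i : Fin (l + 1), z i.succ = p[i.1]'(by omega) := fun _ => rfl
  have hzp : ∀ i, i ≠ 0 → z i ∈ p := by
    intro i hi
    obtain ⟨i, rfl⟩ := Fin.exists_succ_eq.mpr hi
    rw [hzs]
    exact List.getElem_mem _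
  have hvp : v ∉ p := fun h => (hpv v h).ne rfl
  have hzinj : Function.Injective z := by
    refine Fin.cons_injective_iff.mpr ⟨?_, ?_⟩
    · rintro ⟨i, hi⟩
      exact hvp (hi ▸ List.getElem_mem _)
    · intro a b hab
      exact Fin.ext ((hpn.getElem_inj_iff).mp hab)
  have hzadj : ∀ i, G.Adj (z i) (z (i + 1)) := by
    intro i
    by_cases h1 : i + 1 = 0
    · rw [h1, hz0]
      refine (hpv _ (hzp i ?_)).symm
      rintro rfl
      simp at h1
    · by_cases h0 : i = 0
      · rw [h0, hz0]
        exact hpv _ (hzp _ (by rwa [h0] at h1))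
      · obtain ⟨i, rfl⟩ := Fin.exists_succ_eq.mpr h0
        have hlast : i.1 ≠ l := by
          intro h
          apply h1
          ext
          simp [Fin.val_add, h]
        have hi : i.succ + 1 = Fin.succ ⟨i.1 + 1, by omega⟩ := by
          ext
          simp only [Fin.val_add, Fin.val_succ, Fin.val_one]
          exact Nat.mod_eq_of_lt (by omega)
        rw [hi, hzs, hzs]
        exact List.isChain_iff_getElem.mp hpc i.1 (by omega)
  have hSnot : ∀ w, w ∉ Set.range c → w ∈ S := fun w hw => (hcov w).resolve_left hw
  -- Rotating by `r` sends `c r` to `v`. Chords then come for free, as `v` sees all of `p`; `f` is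
  -- used only for endpoints off the cycle.
  let g : W → V := fun w =>
    if h : w ∈ Set.range c then z (h.choose - r) else (f ⟨w, hSnot w h⟩ : V)
  have hgc : ∀ a, g (c a) = z (a - r) := by
    intro a
    have h : c a ∈ Set.range c := ⟨a, rfl⟩
    simp only [g, dif_pos h]
    rw [c.injective h.choose_spec]
  have hgS : ∀ w (h : w ∉ Set.range c), g w = f ⟨w, hSnot w h⟩ := fun w h => by
    simp only [g, dif_neg h]
  have hgB : ∀ w, w ∉ Set.range c → G.Adj v (g w) ∧ g w ∉ p := by
    intro w hw
    rw [hgS w hw]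
    exact hB _ (f _).2
  have hgr : g (c r) = v := by rw [hgc, sub_self, hz0]
  have hzB : ∀ a w, w ∉ Set.range c → g (c a) ≠ g w := by
    intro a w hw h
    rw [hgc] at h
    by_cases h0 : a - r = 0
    · rw [h0, hz0] at h
      exact (hgB w hw).1.ne h
    · exact (hgB w hw).2 (h ▸ hzp _ h0)
  have hginj : Function.Injective g := by
    intro w w' h
    by_cases hw : w ∈ Set.range c <;> by_cases hw' : w' ∈ Set.range c
    · obtain ⟨a, rfl⟩ := hw
      obtain ⟨b, rfl⟩ := hw'
      rw [hgc, hgc] at h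
      rw [sub_left_injective (hzinj h)]
    · obtain ⟨a, rfl⟩ := hw
      exact absurd h (hzB a w' hw')
    · obtain ⟨b, rfl⟩ := hw'
      exact absurd h.symm (hzB b w hw)
    · rw [hgS w hw, hgS w' hw'] at h
      simpa using f.injective (Subtype.ext h)
  have hrs : ∀ s ∈ S, G.Adj (g (c r)) (g s) := by
    intro s hs
    rw [hgr]
    by_cases hsc : s ∈ Set.range c
    · obtain ⟨a, rfl⟩ := hsc
      rw [hgc]
      refine hpv _ (hzp _ fun h => hrS ?_)
      rwa [sub_eq_zero.mp h] at hs
    · exact (hgB s hsc).1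
  have hcyc : ∀ a, G.Adj (g (c a)) (g (c (a + 1))) := by
    intro a
    rw [hgc, hgc, add_sub_right_comm]
    exact hzadj _
  refine ⟨⟨⟨g, ?_⟩, hginj⟩⟩
  intro a b hab
  rcases (hadj a b).mp hab with h | ⟨rfl, hb⟩ | ⟨rfl, ha⟩
  · obtain ⟨x, y, hxy, rfl, rfl⟩ := (SimpleGraph.map_adj _ _ _ _).mp h
    rcases SimpleGraph.cycleGraph_adj.mp hxy with h | h
    · rw [sub_eq_iff_eq_add'.mp h]
      exact (hcyc y).symm
    · rw [sub_eq_iff_eq_add'.mp h]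
      exact hcyc x
  · exact hrs b hb
  · exact (hrs a ha).symm

lemma IsCycleWithEdges.degree_le_of_free {l j s : ℕ} (hj : j ≤ l) (hs : 1 ≤ s) {W V : Type*}
    [Fintype V] {H : SimpleGraph W} (hH : IsCycleWithEdges (l + 2) j H) (G : SimpleGraph V)
    [DecidableRel G.Adj] (hfree : H.Free G)
    (hind : ¬ (completeBipartiteGraph (Fin 1) (Fin (s + 2))).IsIndContained G) (v : V) :
    G.degree v ≤ l * (s + 1) := by
  classical
  by_contra! hlt
  rw [← SimpleGraph.card_neighborFinset_eq_degree] at hlt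
  rcases G.exists_isIndepSet_or_path l (s + 1) _ hlt with ⟨I, hIA, hIc, hI⟩ | ⟨p, h1, h2, h3, h4⟩
  · exact hind (G.star_isIndContained_of_isIndepSet v I
      (fun x hx => by simpa using hIA hx) hI hIc)
  · refine hfree (hH.isContained G v p h1 h2 (fun x hx => by simpa using h3 x hx) h4
      (G.neighborFinset v \ p.toFinset) (fun x hx => by simpa using hx) ?_)
    have hsub : p.toFinset ⊆ G.neighborFinset v := fun x hx => h3 x (by simpa using hx)
    have hcard := Finset.card_sdiff_add_card_eq_card hsub
    rw [List.toFinset_card_of_nodup h2, h4] at hcard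
    -- Off the path at least `l * (s + 1) + 1 - (l + 1) = l * s ≥ l ≥ j` neighbours remain.
    have : l * 1 ≤ l * s := Nat.mul_le_mul_left l hs
    rw [Nat.mul_succ] at hlt
    omega

/-! ### Truncated free products acting on words. -/

section ReducedWords

variable {ι A : Type*}

/-- A list of letters `(i, a)`, with `a` in the `i`-th copy of `A`, is a reduced word of the free
product of copies of `A` when no letter is trivial and neighbouring letters are in distinct
copies. -/
def IsReducedWord [Zero A] (w : List (ι × A)) : Prop :=
  w.IsChain (fun x y => x.1 ≠ y.1) ∧ ∀ x ∈ w, x.2 ≠ 0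

/-- The word `w` has no first letter in the `i`-th copy. -/
def AvoidsHead (i : ι) (w : List (ι × A)) : Prop := ∀ x ∈ w.head?, x.1 ≠ i

lemma avoidsHead_nil (i : ι) : AvoidsHead i ([] : List (ι × A)) := by simp [AvoidsHead]

variable [AddGroup A] [DecidableEq A] (N : ℕ)

/-- Prepend the letter `(i, a)`, unless it is trivial or `w` already has length `N`. -/
def consLetter (i : ι) (a : A) (w : List (ι × A)) : List (ι × A) :=
  if a = 0 ∨ N ≤ w.length then w else (i, a) :: w

variable {N}

lemma consLetter_of_lt {i : ι} {a : A} {w : List (ι × A)} (ha : a ≠ 0) (hw : w.length < N) :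
    consLetter N i a w = (i, a) :: w := by
  rw [consLetter, if_neg]
  simp [ha, hw]

@[simp] lemma consLetter_zero (i : ι) (w : List (ι × A)) : consLetter N i (0 : A) w = w := by
  simp [consLetter]

lemma consLetter_of_le {i : ι} {a : A} {w : List (ι × A)} (hw : N ≤ w.length) :
    consLetter N i a w = w := by
  simp [consLetter, hw]

lemma IsReducedWord.consLetter_of_avoidsHead {i : ι} {w : List (ι × A)} (hw : IsReducedWord w)
    (hi : AvoidsHead i w) (a : A) : IsReducedWord (consLetter N i a w) := by
  by_cases h : a = 0 ∨ N ≤ w.length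
  · simpa [consLetter, h] using hw
  · rw [consLetter, if_neg h]
    push Not at h
    refine ⟨?_, ?_⟩
    · cases w with
      | nil => simp
      | cons x w => exact List.isChain_cons_cons.mpr ⟨(hi x (by simp)).symm, hw.1⟩
    · intro x hx
      rcases List.mem_cons.mp hx with rfl | hx
      · exact h.1
      · exact hw.2 x hx

lemma length_consLetter_le (i : ι) (a : A) (w : List (ι × A)) :
    (consLetter N i a w).length ≤ w.length + 1 := by
  unfold consLetter
  split_ifs <;> simp

lemma length_consLetter_le_bound {i : ι} {a : A} {w : List (ι × A)} (hw : w.length ≤ N) :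
    (consLetter N i a w).length ≤ N := by
  unfold consLetter
  split_ifs with h
  · exact hw
  · push Not at h
    simpa using h.2

variable [DecidableEq ι]

variable (N) in
/-- Left multiplication of a word by the letter `(i, a)`, truncated at length `N`. -/
def mulLetter (i : ι) (a : A) : List (ι × A) → List (ι × A)
  | [] => consLetter N i a []
  | (j, b) :: w => if j = i then consLetter N i (a + b) w else consLetter N i a ((j, b) :: w)

lemma mulLetter_of_avoidsHead {i : ι} (a : A) {w : List (ι × A)} (hw : AvoidsHead i w) :
    mulLetter N i a w = consLetter N i a w := by
  cases w with
  | nil => rfl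
  | cons x w =>
    have : x.1 ≠ i := hw x (by simp)
    simp [mulLetter, this]

/-- This survives truncation: if `w` has length `N`, both sides are `w`. Hence letters of one copy
still act as a group. -/
lemma mulLetter_consLetter {i : ι} (a b : A) {w : List (ι × A)} (hw : AvoidsHead i w) :
    mulLetter N i a (consLetter N i b w) = consLetter N i (a + b) w := by
  by_cases hb : b = 0
  · simp [hb, mulLetter_of_avoidsHead a hw]
  · rcases lt_or_ge w.length N with hl | hl
    · simp [consLetter_of_lt hb hl, mulLetter]
    · simp only [consLetter_of_le hl, mulLetter_of_avoidsHead a hw]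

/-- Splitting off a possibly trivial `i`-letter reduces identities for `mulLetter` to addition in
`A`. -/
lemma IsReducedWord.exists_eq_consLetter {w : List (ι × A)} (hw : IsReducedWord w)
    (hl : w.length ≤ N) (i : ι) : ∃ b w', w = consLetter N i b w' ∧ AvoidsHead i w' ∧
      IsReducedWord w' ∧ w'.length ≤ w.length ∧ (b = 0 ∨ w'.length < w.length) := by
  by_cases h : AvoidsHead i w
  · exact ⟨0, w, by simp, h, hw, le_rfl, Or.inl rfl⟩
  · cases w with
    | nil => exact absurd (avoidsHead_nil i) h
    | cons x w =>
      have hx : x.1 = i := by simpa [AvoidsHead] using h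
      have hlw : w.length < N := by simpa using hl
      refine ⟨x.2, w, ?_, ?_, ⟨hw.1.tail, fun y hy => hw.2 y (by simp [hy])⟩, by simp,
        Or.inr (by simp)⟩
      · rw [consLetter_of_lt (hw.2 x (by simp)) hlw, ← hx]
      · intro y hy
        cases w with
        | nil => simp at hy
        | cons z w =>
          obtain rfl : z = y := by simpa using hy
          rw [← hx]
          exact (List.isChain_cons_cons.mp hw.1).1.symm

lemma length_mulLetter_le (i : ι) (a : A) (w : List (ι × A)) :
    (mulLetter N i a w).length ≤ w.length + 1 := by
  cases w with
  | nil => exact length_consLetter_le i a _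
  | cons x w =>
    rw [mulLetter]
    split_ifs
    · exact (length_consLetter_le i _ _).trans (by simp)
    · exact length_consLetter_le i _ _

variable (ι A N) in
/-- The reduced words of length at most `N`. -/
abbrev BoundedWord : Type _ := {w : List (ι × A) // IsReducedWord w ∧ w.length ≤ N}

instance BoundedWord.finite [Finite ι] [Finite A] : Finite (BoundedWord ι A N) :=
  ((List.finite_length_le (ι × A) N).subset fun _ hw => hw.2).to_subtype

lemma IsReducedWord.mulLetter_of_length_le {w : List (ι × A)} (hw : IsReducedWord w) (hl : w.length ≤ N)
    (i : ι) (a : A) : IsReducedWord (mulLetter N i a w) ∧ (mulLetter N i a w).length ≤ N := by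
  obtain ⟨b, w', rfl, h1, h2, h3, -⟩ := hw.exists_eq_consLetter hl i
  rw [mulLetter_consLetter a b h1]
  exact ⟨h2.consLetter_of_avoidsHead h1 _, length_consLetter_le_bound (h3.trans hl)⟩

lemma IsReducedWord.mulLetter_mulLetter {w : List (ι × A)} (hw : IsReducedWord w)
    (hl : w.length ≤ N) (i : ι) (a b : A) :
    mulLetter N i a (mulLetter N i b w) = mulLetter N i (a + b) w := by
  obtain ⟨c, w', rfl, h1, -⟩ := hw.exists_eq_consLetter hl i
  simp only [mulLetter_consLetter _ _ h1, add_assoc]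

lemma IsReducedWord.mulLetter_zero {w : List (ι × A)} (hw : IsReducedWord w)
    (hl : w.length ≤ N) (i : ι) : mulLetter N i 0 w = w := by
  obtain ⟨c, w', rfl, h1, -⟩ := hw.exists_eq_consLetter hl i
  simp only [mulLetter_consLetter _ _ h1, zero_add]

variable (N) in
/-- The permutation of the bounded words given by truncated multiplication by a letter. -/
def letterPerm (i : ι) (a : A) : Equiv.Perm (BoundedWord ι A N) where
  toFun w := ⟨mulLetter N i a w, w.2.1.mulLetter_of_length_le w.2.2 i a⟩
  invFun w := ⟨mulLetter N i (-a) w, w.2.1.mulLetter_of_length_le w.2.2 i (-a)⟩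
  left_inv w := Subtype.ext <| by
    simp only [w.2.1.mulLetter_mulLetter w.2.2, neg_add_cancel, w.2.1.mulLetter_zero w.2.2]
  right_inv w := Subtype.ext <| by
    simp only [w.2.1.mulLetter_mulLetter w.2.2, add_neg_cancel, w.2.1.mulLetter_zero w.2.2]

lemma letterPerm_add (i : ι) (a b : A) :
    letterPerm N i (a + b) = letterPerm N i a * letterPerm N i b :=
  Equiv.ext fun w => Subtype.ext (w.2.1.mulLetter_mulLetter w.2.2 i a b).symm

@[simp] lemma letterPerm_zero (i : ι) : letterPerm N i (0 : A) = 1 :=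
  Equiv.ext fun w => Subtype.ext (w.2.1.mulLetter_zero w.2.2 i)

lemma letterPerm_neg_mul (i : ι) (a : A) : letterPerm N i (-a) * letterPerm N i a = 1 := by
  rw [← letterPerm_add, neg_add_cancel, letterPerm_zero]

variable (ι A N) in
/-- The empty word. -/
def emptyBoundedWord : BoundedWord ι A N := ⟨[], by simp [IsReducedWord], by simp⟩

lemma letterPerm_emptyBoundedWord (hN : 0 < N) (i : ι) {a : A} (ha : a ≠ 0) :
    (letterPerm N i a (emptyBoundedWord ι A N) : List (ι × A)) = [(i, a)] :=
  consLetter_of_lt ha (by simpa using hN)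

lemma letterPerm_injective (hN : 0 < N) {i j : ι} {a b : A} (ha : a ≠ 0) (hb : b ≠ 0)
    (h : letterPerm N i a = letterPerm N j b) : i = j ∧ a = b := by
  have := letterPerm_emptyBoundedWord hN i ha
  rw [h, letterPerm_emptyBoundedWord hN j hb] at this
  simpa [eq_comm] using this

lemma letterPerm_ne_one (hN : 0 < N) (i : ι) {a : A} (ha : a ≠ 0) : letterPerm N i a ≠ 1 := by
  intro h
  have := letterPerm_emptyBoundedWord hN i ha
  rw [h] at this
  simp [emptyBoundedWord] at this

variable (N) in
/-- The product of the permutations given by the letters of a word. -/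
def wordPerm (w : List (ι × A)) : Equiv.Perm (BoundedWord ι A N) :=
  (w.map fun x => letterPerm N x.1 x.2).prod

lemma wordPerm_consLetter (i : ι) (a : A) {w : List (ι × A)} (hw : w.length < N) :
    wordPerm N (consLetter N i a w) = letterPerm N i a * wordPerm N w := by
  by_cases ha : a = 0
  · simp [ha]
  · simp [consLetter_of_lt ha hw, wordPerm]

lemma IsReducedWord.wordPerm_mulLetter {w : List (ι × A)} (hw : IsReducedWord w)
    (hl : w.length < N) (i : ι) (a : A) :
    wordPerm N (mulLetter N i a w) = letterPerm N i a * wordPerm N w := by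
  obtain ⟨b, w', rfl, h1, -, h3, -⟩ := hw.exists_eq_consLetter hl.le i
  have hl' := h3.trans_lt hl
  rw [mulLetter_consLetter a b h1, wordPerm_consLetter i _ hl', wordPerm_consLetter i _ hl',
    letterPerm_add, mul_assoc]

/-- A neighbour of the word `(i, b) :: q` that is not longer lies in the block of `q` in
direction `i`. -/
lemma mulLetter_mem_block {i i' : ι} {a b : A} {q : List (ι × A)}
    (hq : ((i, b) :: q).length < N) (hle : (mulLetter N i' a ((i, b) :: q)).length ≤ q.length + 1) :
    ∃ c, mulLetter N i' a ((i, b) :: q) = consLetter N i c q ∨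
      mulLetter N i' a ((i, b) :: q) = (i, b) :: q := by
  rw [mulLetter] at hle ⊢
  split_ifs at hle ⊢ with h
  · exact ⟨a + b, Or.inl (by rw [h])⟩
  · refine ⟨0, Or.inr ?_⟩
    by_cases ha : a = 0
    · simp [ha]
    · rw [consLetter_of_lt ha hq] at hle
      simp at hle

end ReducedWords

/-! ### Cycles in the tree of blocks. -/

open Fin.CommRing in
/-- On a cycle, a set that can only be left through the vertex `e` and that contains some vertex
other than `e` is everything. -/
lemma Fin.forall_of_step {n : ℕ} (P : Fin (n + 2) → Prop) (e j₀ : Fin (n + 2)) (hj : j₀ ≠ e)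
    (h₀ : P j₀) (hup : ∀ j, P j → j ≠ e → P (j + 1)) (hdown : ∀ j, P (j + 1) → j + 1 ≠ e → P j)
    (j : Fin (n + 2)) : P j := by
  have hne : ∀ m : ℕ, 0 < m → m < n + 2 → e + (m : Fin (n + 2)) ≠ e := by
    intro m hm hmn h
    have := (Fin.natCast_eq_zero).mp (add_eq_left.mp h)
    exact absurd (Nat.le_of_dvd hm this) (by omega)
  have hcast : ∀ j : Fin (n + 2), ∃ m < n + 2, j = e + (m : Fin (n + 2)) := fun j =>
    ⟨(j - e).1, (j - e).2, by simp⟩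
  obtain ⟨m₀, hm₀, rfl⟩ := hcast j₀
  obtain ⟨m, hm, rfl⟩ := hcast j
  have hpos : 0 < m₀ := Nat.pos_of_ne_zero (by rintro rfl; simp at hj)
  rcases le_total m₀ m with hle | hle
  · induction m, hle using Nat.le_induction with
    | base => exact h₀
    | succ m hle ih =>
      rw [Nat.cast_succ, ← add_assoc]
      exact hup _ (ih (by omega)) (hne m (by omega) (by omega))
  · refine Nat.decreasingInduction (motive := fun m _ => P (e + (m : Fin (n + 2))))
      (fun m hle ih => ?_) h₀ hle
    have := hne (m + 1) (by omega) (by omega)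
    rw [Nat.cast_succ, ← add_assoc] at this ih
    exact hdown _ ih this

section WordCycles

variable {ι A : Type*} [AddGroup A] [DecidableEq ι] [DecidableEq A] {N : ℕ}

/-- In the tree of blocks formed by the reduced words there is no cycle that is longer than the
size of a block. -/
lemma false_of_cycle_of_words [Fintype A] {n : ℕ} (hn : Fintype.card A < n + 2)
    (x : Fin (n + 2) → List (ι × A)) (hinj : Function.Injective x)
    (hred : ∀ j, IsReducedWord (x j)) (hlen : ∀ j, (x j).length < N)
    (hstep : ∀ j, ∃ i a, x (j + 1) = mulLetter N i a (x j)) : False := by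
  obtain ⟨j₀, hmax⟩ := Finite.exists_max fun j => (x j).length
  have hstep' : ∀ j, ∃ i a, x j = mulLetter N i a (x (j + 1)) := by
    intro j
    obtain ⟨i, a, h⟩ := hstep j
    refine ⟨i, -a, ?_⟩
    rw [h, (hred j).mulLetter_mulLetter (hlen j).le, neg_add_cancel,
      (hred j).mulLetter_zero (hlen j).le]
  rcases hx : x j₀ with _ | ⟨⟨i, b⟩, q⟩
  · have h0 : ∀ j, x j = [] := fun j => List.length_eq_zero_iff.mp (by
      have := hmax j
      simpa [hx] using this)
    exact absurd (hinj ((h0 0).trans (h0 1).symm)) (by simp)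
  · have hmax' : ∀ j, (x j).length ≤ q.length + 1 := fun j => by simpa [hx] using hmax j
    have hqN : q.length < N := by
      have := hlen j₀
      rw [hx, List.length_cons] at this
      omega
    have hb : b ≠ 0 := (hred j₀).2 (i, b) (by simp [hx])
    -- By maximality of `q.length + 1`, the cycle can leave the block above `q` only through `q`.
    have hblock : ∀ j j', (∃ i a, x j' = mulLetter N i a (x j)) →
        (∃ c, x j = consLetter N i c q) → x j ≠ q → ∃ c, x j' = consLetter N i c q := by
      rintro j j' ⟨i', a, h⟩ ⟨c, hc⟩ hne
      have hc0 : c ≠ 0 := by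
        rintro rfl
        exact hne (by simpa using hc)
      rw [consLetter_of_lt hc0 hqN] at hc
      have h1 := hmax' j'
      have h2 := hlen j
      rw [h, hc] at h1
      rw [hc] at h2
      rw [h, hc]
      obtain ⟨d, hd | hd⟩ := mulLetter_mem_block h2 h1
      · exact ⟨d, hd⟩
      · exact ⟨c, by rw [hd, consLetter_of_lt hc0 hqN]⟩
    have hj₀q : x j₀ ≠ q := by
      rw [hx]
      exact List.cons_ne_self _ _
    -- Injectivity makes the exit unique; if `q` is never visited, any index other than `j₀` serves.
    obtain ⟨e, he, hej⟩ : ∃ e, (∀ j, x j = q → j = e) ∧ j₀ ≠ e := by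
      by_cases h : ∃ e, x e = q
      · obtain ⟨e, he⟩ := h
        exact ⟨e, fun j hj => hinj (hj.trans he.symm), fun h => hj₀q (h ▸ he)⟩
      · exact ⟨j₀ + 1, fun j hj => absurd ⟨j, hj⟩ h, by simp⟩
    have hall : ∀ j, ∃ c, x j = consLetter N i c q :=
      Fin.forall_of_step _ e j₀ hej ⟨b, by rw [hx, consLetter_of_lt hb hqN]⟩
        (fun j hj hne => hblock j (j + 1) (hstep j) hj fun h => hne (he j h))
        (fun j hj hne => hblock (j + 1) j (hstep' j) hj fun h => hne (he _ h))
    choose f hf using hall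
    have hfinj : Function.Injective f := fun j j' h => hinj (by rw [hf j, hf j', h])
    have := Fintype.card_le_of_injective f hfinj
    rw [Fintype.card_fin] at this
    omega

/-! ### The finite Cayley graph. -/

variable (ι A N) in
/-- `m` disjoint copies of the Cayley graph of the permutations of the bounded words, with respect
to the nontrivial letters. -/
def letterGraph (m : ℕ) : SimpleGraph (Equiv.Perm (BoundedWord ι A N) × Fin m) where
  Adj g h := g ≠ h ∧ g.2 = h.2 ∧ ∃ i a, h.1 = letterPerm N i a * g.1
  symm := ⟨by
    rintro g h ⟨hne, h2, i, a, h1⟩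
    refine ⟨hne.symm, h2.symm, i, -a, ?_⟩
    rw [h1, ← mul_assoc, letterPerm_neg_mul, one_mul]⟩
  loopless := ⟨fun g h => h.1 rfl⟩

lemma letterGraph_adj_iff (hN : 0 < N) {m : ℕ} {g h : Equiv.Perm (BoundedWord ι A N) × Fin m} :
    (letterGraph ι A N m).Adj g h ↔
      ∃ i a, a ≠ 0 ∧ h = (letterPerm N i a * g.1, g.2) := by
  constructor
  · rintro ⟨hne, h2, i, a, h1⟩
    refine ⟨i, a, ?_, Prod.ext h1 h2.symm⟩
    rintro rfl
    exact hne (Prod.ext (by simp [h1]) h2)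
  · rintro ⟨i, a, ha, rfl⟩
    refine ⟨fun h => letterPerm_ne_one hN i ha ?_, rfl, i, a, rfl⟩
    simpa using (congrArg Prod.fst h).symm

lemma letterGraph_degree [Fintype ι] [Fintype A] (hN : 0 < N) {m : ℕ}
    (g : Equiv.Perm (BoundedWord ι A N) × Fin m) [Fintype ((letterGraph ι A N m).neighborSet g)] :
    (letterGraph ι A N m).degree g = Fintype.card ι * (Fintype.card A - 1) := by
  classical
  let s : Finset (ι × A) := Finset.univ ×ˢ Finset.univ.erase 0
  have himg : (letterGraph ι A N m).neighborFinset g =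
      s.image fun x => (letterPerm N x.1 x.2 * g.1, g.2) := by
    ext h
    simp [s, letterGraph_adj_iff hN, eq_comm]
  rw [← SimpleGraph.card_neighborFinset_eq_degree, himg, Finset.card_image_of_injOn]
  · simp [s, Finset.card_erase_of_mem]
  · intro x hx y hy hxy
    have hx0 : x.2 ≠ 0 := by simpa [s] using hx
    have hy0 : y.2 ≠ 0 := by simpa [s] using hy
    have := letterPerm_injective hN hx0 hy0 (mul_right_cancel (congrArg Prod.fst hxy))
    exact Prod.ext this.1 this.2

/-- Two leaves reached by letters of the same copy of `A` differ by a letter of that copy, so they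
are adjacent. -/
lemma letterGraph_not_star_isIndContained [Fintype ι] (hN : 0 < N) {m t : ℕ}
    (ht : Fintype.card ι < t) :
    ¬ (completeBipartiteGraph (Fin 1) (Fin t)).IsIndContained (letterGraph ι A N m) := by
  rintro ⟨f⟩
  have hadj : ∀ b : Fin t, (letterGraph ι A N m).Adj (f (Sum.inl 0)) (f (Sum.inr b)) := fun b =>
    f.map_adj_iff.mpr (by simp)
  choose i a ha hf using fun b => (letterGraph_adj_iff hN).mp (hadj b)
  obtain ⟨b, c, hbc, hi⟩ := Fintype.exists_ne_map_eq_of_card_lt i (by simpa using ht)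
  have : (letterGraph ι A N m).Adj (f (Sum.inr b)) (f (Sum.inr c)) := by
    refine ⟨fun h => hbc (by simpa using f.injective h), by rw [hf b, hf c], i b,
      a c + -a b, ?_⟩
    rw [hf b, hf c, ← hi, ← mul_assoc, ← letterPerm_add, neg_add_cancel_right]
  simpa using f.map_adj_iff.mp this

lemma letterGraph_cycleGraph_free [Fintype A] {m n : ℕ} (hn : Fintype.card A < n + 2)
    (hN : n + 2 ≤ N) : (SimpleGraph.cycleGraph (n + 2)).Free (letterGraph ι A N m) := by
  rintro ⟨f⟩
  have hadj : ∀ j, (letterGraph ι A N m).Adj (f j) (f (j + 1)) := fun j =>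
    f.toHom.map_adj (SimpleGraph.cycleGraph_adj.mpr (Or.inr (by simp)))
  let x : Fin (n + 2) → BoundedWord ι A N := fun j =>
    ((f j).1 * (f 0).1⁻¹) (emptyBoundedWord ι A N)
  have hstep : ∀ j, ∃ i a, (f (j + 1)).1 = letterPerm N i a * (f j).1 ∧
      (x (j + 1) : List (ι × A)) = mulLetter N i a (x j) := by
    intro j
    obtain ⟨-, -, i, a, h⟩ := hadj j
    refine ⟨i, a, h, ?_⟩
    simp only [x, h, mul_assoc]
    rfl
  -- Before closing up, the words stay shorter than `N`, so truncation is not felt and each vertex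
  -- is recovered from its word. Thus distinct vertices give distinct words.
  have hkey : ∀ k : ℕ, ∀ hk : k < n + 2, (x ⟨k, hk⟩ : List (ι × A)).length ≤ k ∧
      f ⟨k, hk⟩ = (wordPerm N (x ⟨k, hk⟩ : List (ι × A)) * (f 0).1, (f 0).2) := by
    intro k
    induction k with
    | zero =>
      intro hk
      have h0 : (⟨0, hk⟩ : Fin (n + 2)) = 0 := rfl
      simp [h0, x, emptyBoundedWord, wordPerm]
    | succ k ih =>
      intro hk
      obtain ⟨h1, h2⟩ := ih (by omega)
      have hs : (⟨k + 1, hk⟩ : Fin (n + 2)) = ⟨k, by omega⟩ + 1 := by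
        ext
        simp only [Fin.val_add, Fin.val_one]
        exact (Nat.mod_eq_of_lt hk).symm
      obtain ⟨i, a, h3, h4⟩ := hstep ⟨k, by omega⟩
      rw [hs, h4]
      refine ⟨(length_mulLetter_le i a _).trans (by omega), Prod.ext ?_ ?_⟩
      · rw [h3, (x _).2.1.wordPerm_mulLetter (by omega), mul_assoc]
        exact congrArg _ (congrArg Prod.fst h2)
      · exact ((hadj _).2.1).symm.trans (by rw [h2])
  refine false_of_cycle_of_words (N := N) hn (fun j => (x j : List (ι × A))) ?_
    (fun j => (x j).2.1) (fun j => ((hkey j.1 j.2).1).trans_lt (by omega)) fun j => ?_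
  · intro j j' h
    apply f.injective
    have h1 := (hkey j.1 j.2).2
    have h2 := (hkey j'.1 j'.2).2
    simp only at h
    simp only [Fin.eta] at h1 h2
    exact h1.trans (Eq.trans (by rw [h]) h2.symm)
  · obtain ⟨i, a, -, h⟩ := hstep j
    exact ⟨i, a, h⟩

end WordCycles

/-! ### From degrees to edge counts, and the theorem. -/

lemma IsCycleWithEdges.cycleGraph_isContained {k j : ℕ} {W : Type*} {H : SimpleGraph W}
    (hH : IsCycleWithEdges k j H) : (SimpleGraph.cycleGraph k).IsContained H := by
  obtain ⟨c, r, S, -, -, -, -, hadj⟩ := hH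
  exact ⟨⟨⟨c, fun h => (hadj _ _).mpr (Or.inl ((SimpleGraph.map_adj _ _ _ _).mpr
    ⟨_, _, h, rfl, rfl⟩))⟩, c.injective⟩⟩

lemma inducedTuranNumber_le_of_degree_le {U W : Type*} {n d : ℕ} {P : SimpleGraph U}
    {Q : SimpleGraph W} (h : ∀ (G : SimpleGraph (Fin n)) [DecidableRel G.Adj], P.Free G →
      ¬ Q.IsIndContained G → ∀ v, G.degree v ≤ d) :
    2 * inducedTuranNumber n P Q ≤ n * d := by
  classical
  suffices inducedTuranNumber n P Q ≤ n * d / 2 by omega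
  refine Finset.sup_le fun G hG => ?_
  rw [Finset.mem_filter] at hG
  rw [Nat.le_div_iff_mul_le two_pos, mul_comm]
  have h1 := G.sum_degrees_eq_twice_card_edges
  have h2 : ∑ v, G.degree v ≤ ∑ _v : Fin n, d :=
    Finset.sum_le_sum fun v _ => h G hG.2.1 hG.2.2 v
  rw [h1] at h2
  simp only [Finset.sum_const, Finset.card_univ, Fintype.card_fin, smul_eq_mul] at h2
  convert h2

lemma le_inducedTuranNumber_of_isRegularOfDegree {U W V : Type*} [Fintype V] {d : ℕ}
    {P : SimpleGraph U} {Q : SimpleGraph W} (G : SimpleGraph V) [DecidableRel G.Adj]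
    (hfree : P.Free G) (hind : ¬ Q.IsIndContained G) (hdeg : G.IsRegularOfDegree d) :
    Fintype.card V * d ≤ 2 * inducedTuranNumber (Fintype.card V) P Q := by
  classical
  let e := G.overFinIso rfl
  have hle : (G.overFin rfl).edgeFinset.card ≤ inducedTuranNumber (Fintype.card V) P Q := by
    unfold inducedTuranNumber
    convert Finset.le_sup (f := fun G : SimpleGraph (Fin (Fintype.card V)) => G.edgeFinset.card)
      (b := G.overFin rfl) ?_
    rw [Finset.mem_filter]
    refine ⟨Finset.mem_univ _, ?_, ?_⟩
    · exact fun h => hfree (h.trans ⟨e.symm.toCopy⟩)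
    · exact fun h => hind (h.trans ⟨e.symm.toEmbedding⟩)
  rw [← e.card_edgeFinset_eq] at hle
  have h1 := G.sum_degrees_eq_twice_card_edges
  simp only [hdeg.degree_eq, Finset.sum_const, Finset.card_univ, smul_eq_mul] at h1
  omega

theorem corollary3 (k j t : ℕ) (hk : 3 ≤ k) (hj : j ≤ k - 2) (ht : 3 ≤ t)
    {W : Type*} (H : SimpleGraph W) (hH : IsCycleWithEdges k j H) :
    (∀ n : ℕ,
      (inducedTuranNumber n H (completeBipartiteGraph (Fin 1) (Fin t)) : ℝ)
        ≤ 1 / 2 * ((k : ℝ) - 2) * ((t : ℝ) - 1) * (n : ℝ)) ∧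
    {n : ℕ |
      (inducedTuranNumber n H (completeBipartiteGraph (Fin 1) (Fin t)) : ℝ)
        = 1 / 2 * ((k : ℝ) - 2) * ((t : ℝ) - 1) * (n : ℝ)}.Infinite := by
  classical
  obtain ⟨l, rfl⟩ := Nat.exists_eq_add_of_le' (by omega : 2 ≤ k)
  obtain ⟨s, rfl⟩ := Nat.exists_eq_add_of_le' (by omega : 2 ≤ t)
  have hupper : ∀ n : ℕ,
      (inducedTuranNumber n H (completeBipartiteGraph (Fin 1) (Fin (s + 2))) : ℝ)
        ≤ 1 / 2 * (((l + 2 : ℕ) : ℝ) - 2) * (((s + 2 : ℕ) : ℝ) - 1) * (n : ℝ) := by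
    intro n
    have h := inducedTuranNumber_le_of_degree_le (n := n) (P := H)
      (Q := completeBipartiteGraph (Fin 1) (Fin (s + 2)))
      fun G _ hG hG' v => hH.degree_le_of_free hj (by omega) G hG hG' v
    have h' : (2 : ℝ) * inducedTuranNumber n H (completeBipartiteGraph (Fin 1) (Fin (s + 2)))
        ≤ n * (l * (s + 1)) := by exact_mod_cast h
    push_cast
    linarith
  refine ⟨hupper, Set.infinite_of_not_bddAbove ?_⟩
  rintro ⟨B, hB⟩
  -- Blocks have `k - 1` elements, truncation at `k` suffices for `C_k`, and `B + 1` copies push the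
  -- order past `B`.
  let V := Equiv.Perm (BoundedWord (Fin (s + 1)) (ZMod (l + 1)) (l + 2)) × Fin (B + 1)
  let G : SimpleGraph V := letterGraph (Fin (s + 1)) (ZMod (l + 1)) (l + 2) (B + 1)
  have : Fintype V := Fintype.ofFinite V
  have hlower := le_inducedTuranNumber_of_isRegularOfDegree (P := H)
    (Q := completeBipartiteGraph (Fin 1) (Fin (s + 2))) (d := (s + 1) * l) G
    (fun h => letterGraph_cycleGraph_free (by simp [ZMod.card]) le_rfl
      (hH.cycleGraph_isContained.trans h))
    (letterGraph_not_star_isIndContained (by omega) (by simp))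
    (fun g => by
      rw [letterGraph_degree (by omega)]
      simp [ZMod.card])
  have hcard : B + 1 ≤ Fintype.card V := by
    have := Fintype.card_le_of_injective (fun b : Fin (B + 1) => ((1, b) : V))
      fun a b h => congrArg Prod.snd h
    simpa using this
  refine absurd (hB (a := Fintype.card V) (le_antisymm (hupper _) ?_)) (by omega)
  have h' : (Fintype.card V : ℝ) * ((s + 1) * l) ≤ 2 * inducedTuranNumber (Fintype.card V) H
      (completeBipartiteGraph (Fin 1) (Fin (s + 2))) := by exact_mod_cast hlower
  push_cast
  linarith
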